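/- For $k\ge 1$ let $p_k=\sum_{i} x_i^k$ be the power sum symmetric function in countably many variables, and for a partition $\lambda$ with parts $\lambda_1,\lambda_2,\dots$ put $p_\lambda=\prod_i p_{\lambda_i}$ (with $p_\emptyset=1$). For a finite-dimensional complex representation $V$ of the symmetric group $S_n$ with character $\chi_V$, the Frobenius characteristic is $\mathrm{ch}(V)=\frac1{n!}\sum_{w\in S_n}\chi_V(w)\,p_{\mathrm{type}(w)}$, where $\mathrm{type}(w)\vdash n$ is the cycle type of $w$ (fixed points included). Call $V$ self-conjugate if $V\cong V\otimes\mathrm{sgn}$. Let $q$ be a prime and $n\ge 0$. Then: 1. There is a representation $V$ of $S_n$ of dimension $n!$ with $$\mathrm{ch}(V)=\sum_{\substack{\lambda\vdash n\\ \text{all parts of }\lambda\text{ are powers of }q}}p_\lambda ,$$ where $1=q^0$ counts as a power of $q$. If $q$ is odd, then this representation $V$ is self-conjugate. 2. There is a representation of $S_n$ of dimension $n!$ with Frobenius characteristic $$\sum_{\substack{\lambda\vdash n\\ (\lambda_i,q)=1\text{ for all }i}}p_\lambda .$$ 3. If $q$ is odd, there is a representation of $S_n$ of dimension $n!$ with Frobenius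 characteristic $$\sum_{\substack{\lambda\vdash n,\ \lambda_i\text{ odd}\\ (\lambda_i,q)=1\text{ for all }i}}p_\lambda .$$ -/

import Mathlib

open scoped Nat TensorProduct

/-- The power sum symmetric function `p_k = ∑ i, x_i ^ k` (`k ≥ 1`) in countably many variables
`x_0, x_1, x_2, …`. The ring of symmetric functions with complex coefficients is the ring of
symmetric power series of bounded degree, a subring of `MvPowerSeries ℕ ℂ`. -/
noncomputable def powerSum (k : ℕ) : MvPowerSeries ℕ ℂ :=
  open Classical in fun m => if ∃ i : ℕ, m = Finsupp.single i k then 1 else 0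

/-- `p_lam = ∏ i, p_{lam_i}`, the product over the parts of the partition `lam`;
it equals `1` for the empty partition of `0`. -/
noncomputable def powerSumPart {n : ℕ} (lam : n.Partition) : MvPowerSeries ℕ ℂ :=
  (lam.parts.map powerSum).prod

/-- The Frobenius characteristic of a complex representation `ρ` of `S_n` with character `χ`:
`ch ρ = (1 / n!) ∑_{w ∈ S_n} χ(w) p_{type(w)}`, with `type(w)` the cycle type of `w` (fixed points
counted as parts equal to `1`). -/
noncomputable def frobeniusChar {n : ℕ} {V : Type*} [AddCommGroup V] [Module ℂ V]
    (ρ : Representation ℂ (Equiv.Perm (Fin n)) V) : MvPowerSeries ℕ ℂ :=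
  ((n ! : ℕ) : ℂ)⁻¹ •
    ∑ w : Equiv.Perm (Fin n), ρ.character w • powerSumPart w.partition

/-- The one-dimensional sign representation of `S_n`. -/
noncomputable def signRep (n : ℕ) : Representation ℂ (Equiv.Perm (Fin n)) ℂ where
  toFun w := ((Equiv.Perm.sign w : ℤ) : ℂ) • LinearMap.id
  map_one' := by ext; simp
  map_mul' w w' := by ext; simp [mul_comm]

/-- A representation of `S_n` is self-conjugate if it is isomorphic to its tensor product with the
sign representation. -/
def IsSelfConjugate {n : ℕ} {V : Type*} [AddCommGroup V] [Module ℂ V]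
    (ρ : Representation ℂ (Equiv.Perm (Fin n)) V) : Prop :=
  Nonempty (ρ.Equiv (ρ.tprod (signRep n)))

open Classical in
/-- The multiplicity-free sum of the power sums `p_lam` over the partitions `lam` of `n` all of
whose parts satisfy `P`. -/
noncomputable def powerSumSum (n : ℕ) (P : ℕ → Prop) : MvPowerSeries ℕ ℂ :=
  ∑ lam : n.Partition with ∀ i ∈ lam.parts, P i, powerSumPart lam

/-!
For every `r`, the sum of the `p_lam` over the partitions `lam` of `n` whose parts all divide `r` is
the characteristic of a representation of dimension `n !`. It is enough to take for `r` the least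
common multiple of the `i ≤ n` that satisfy the condition on the parts.

The representation is the conjugation action of `S_n` on the functions on `S_n`, twisted by a
cocycle. Along each cycle of length `k` of `w` choose a phase in `ℝ / ℤ` increasing by `1 / k` at
each step; conjugation by `g` carries the cycles of `w` to those of `g * w * g⁻¹`, and the total
rotation against the chosen phases is a cocycle with values in `ℝ / ℤ`. Twist by the `r`-th power
of the corresponding cocycle with values in the circle. The character at `g` is then the sum over
the `w` commuting with `g` of the `r`-th power of the weight of `g`. If `g ^ r = 1`, all these terms
are `1` and the sum is the order of the centralizer of `g`. Otherwise `g` has a cycle of some length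
`d` not dividing `r`; multiplying `w` by the powers of this cycle moves the cocycle of `g` through a
translate of all of `(1 / d) ℤ / ℤ`, and the sum of the `r`-th powers vanishes.

If `r` is odd, the character is supported on even permutations, and since characters determine
representations the representation is self-conjugate.
-/

open Equiv Function

section Character

variable {k G V V' W W' : Type*} [Field k] [Group G] [AddCommGroup V] [Module k V]
  [AddCommGroup V'] [Module k V'] [AddCommGroup W] [Module k W] [AddCommGroup W'] [Module k W']
  {ρ : Representation k G V} {ρ' : Representation k G V'}
  {σ : Representation k G W} {σ' : Representation k G W'}

theorem character_prod [FiniteDimensional k V] [FiniteDimensional k W] (g : G) :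
    (ρ.prod σ).character g = ρ.character g + σ.character g :=
  LinearMap.trace_prodMap' (ρ g) (σ g)

theorem nonempty_prod_equiv_prod (e : ρ.Equiv ρ') (e' : σ.Equiv σ') :
    Nonempty ((ρ.prod σ).Equiv (ρ'.prod σ')) :=
  ⟨.mk (e.toLinearEquiv.prodCongr e'.toLinearEquiv) fun g => LinearMap.ext fun v =>
    Prod.ext (e.toIntertwiningMap.isIntertwining _ _ g v.1)
      (e'.toIntertwiningMap.isIntertwining _ _ g v.2)⟩

theorem isCompl_toSubmodule {K L : Subrepresentation ρ} (h : IsCompl K L) :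
    IsCompl K.toSubmodule L.toSubmodule :=
  ⟨disjoint_iff.2 (congrArg Subrepresentation.toSubmodule h.inf_eq_bot),
    codisjoint_iff.2 (congrArg Subrepresentation.toSubmodule h.sup_eq_top)⟩

theorem nonempty_prod_equiv_of_isCompl {K L : Subrepresentation ρ} (h : IsCompl K L) :
    Nonempty ((K.toRepresentation.prod L.toRepresentation).Equiv ρ) :=
  ⟨.mk (Submodule.prodEquivOfIsCompl _ _ (isCompl_toSubmodule h)) fun g => LinearMap.ext fun v =>
    (map_add (ρ g) (v.1 : V) (v.2 : V)).symm⟩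

theorem nonempty_equiv_range_of_isCompl_ker (f : ρ.IntertwiningMap σ) {K : Subrepresentation ρ}
    (h : IsCompl f.ker K) : Nonempty (K.toRepresentation.Equiv f.range.toRepresentation) :=
  ⟨.mk ((Submodule.quotientEquivOfIsCompl _ _ (isCompl_toSubmodule h)).symm.trans
    f.toLinearMap.quotKerEquivRange) fun g => LinearMap.ext fun v =>
      Subtype.ext (f.isIntertwining _ _ g v)⟩

theorem exists_ker_prod_equiv_and_prod_range_equiv [Finite G] [NeZero (Nat.card G : k)]
    (f : ρ.IntertwiningMap σ) : ∃ R : Subrepresentation σ,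
      Nonempty ((f.ker.toRepresentation.prod f.range.toRepresentation).Equiv ρ) ∧
      Nonempty ((R.toRepresentation.prod f.range.toRepresentation).Equiv σ) := by
  -- Subrepresentations have complements by Maschke's theorem.
  obtain ⟨K, hK⟩ := exists_isCompl f.ker
  obtain ⟨R, hR⟩ := exists_isCompl f.range
  obtain ⟨e⟩ := nonempty_equiv_range_of_isCompl_ker f hK
  obtain ⟨split⟩ := nonempty_prod_equiv_of_isCompl hK
  obtain ⟨e'⟩ := nonempty_prod_equiv_prod (.refl f.ker.toRepresentation) e.symm
  exact ⟨R, ⟨e'.trans split⟩, nonempty_prod_equiv_of_isCompl hR.symm⟩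

theorem exists_intertwiningMap_ne_zero_of_character_eq [Finite G] [CharZero k]
    [FiniteDimensional k V] [FiniteDimensional k W] [Nontrivial V]
    (h : ρ.character = σ.character) : ∃ f : ρ.IntertwiningMap σ, f ≠ 0 := by
  have : Fintype G := Fintype.ofFinite G
  have : Invertible (Nat.card G : k) := invertibleOfNonzero (Nat.cast_ne_zero.2 Nat.card_pos.ne')
  have hfinrank : Module.finrank k (ρ.IntertwiningMap σ) =
      Module.finrank k (ρ.IntertwiningMap ρ) := by
    rw [← Nat.cast_inj (R := k), ← ρ.card_inv_mul_sum_char_mul_char_eq_finrank σ, ← h,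
      ρ.card_inv_mul_sum_char_mul_char_eq_finrank ρ]
  by_contra! hzero
  have : Subsingleton (ρ.IntertwiningMap σ) := subsingleton_of_forall_eq 0 hzero
  have : Subsingleton (ρ.IntertwiningMap ρ) := by
    rw [← Module.finrank_zero_iff (R := k), ← hfinrank, Module.finrank_zero_of_subsingleton]
  obtain ⟨v, hv⟩ := exists_ne (0 : V)
  exact hv (congrArg (· v) (Subsingleton.elim (Representation.IntertwiningMap.id ρ) 0))

theorem nonempty_equiv_of_subsingleton [Subsingleton V] [Subsingleton W]
    (ρ : Representation k G V) (σ : Representation k G W) : Nonempty (ρ.Equiv σ) :=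
  ⟨.mk 0 fun _ => LinearMap.ext fun _ => Subsingleton.elim _ _⟩

theorem nonempty_equiv_of_character_eq [Finite G] [CharZero k] [FiniteDimensional k V]
    [FiniteDimensional k W] (ρ : Representation k G V) (σ : Representation k G W)
    (h : ρ.character = σ.character) : Nonempty (ρ.Equiv σ) := by
  induction hn : Module.finrank k V using Nat.strong_induction_on generalizing V W with
  | h n ih =>
  rcases subsingleton_or_nontrivial V with hV | hV
  · have : Subsingleton W := by
      have h1 := congrFun h 1
      rw [ρ.char_one, σ.char_one, Nat.cast_inj, Module.finrank_zero_of_subsingleton] at h1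
      exact Module.finrank_zero_iff.1 h1.symm
    exact nonempty_equiv_of_subsingleton ρ σ
  obtain ⟨f, hf⟩ := exists_intertwiningMap_ne_zero_of_character_eq h
  obtain ⟨R, ⟨eρ⟩, ⟨eσ⟩⟩ := exists_ker_prod_equiv_and_prod_range_equiv f
  have hker : Module.finrank k f.ker.toSubmodule < Module.finrank k V :=
    Submodule.finrank_lt fun htop => hf <| Representation.IntertwiningMap.ext <|
      LinearMap.ker_eq_top.1 htop
  have hcharacter : f.ker.toRepresentation.character = R.toRepresentation.character := by
    ext g
    have hg := congrFun h g
    rwa [← Representation.char_iso eρ, ← Representation.char_iso eσ, character_prod,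
      character_prod, add_left_inj] at hg
  obtain ⟨e⟩ := ih _ (hn ▸ hker) f.ker.toRepresentation R.toRepresentation hcharacter rfl
  obtain ⟨e'⟩ := nonempty_prod_equiv_prod e (.refl f.range.toRepresentation)
  exact ⟨(eρ.symm.trans e').trans eσ⟩

end Character

section Phase

variable {α : Type*} {g w : Perm α}

/-- A phase of a permutation `w` is a function to `ℝ / ℤ` which increases by `1 / k` at every step
along a cycle of length `k` of `w`, so that it winds once around the circle on each finite cycle. -/
def IsPhase (w : Perm α) (θ : α → UnitAddCircle) : Prop :=
  ∀ x, θ (w x) = θ x + ((1 / minimalPeriod w x : ℝ) : UnitAddCircle)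

theorem coe_natCast_div_eq_of_modEq {i j k : ℕ} (h : i ≡ j [MOD k]) :
    ((i / k : ℝ) : UnitAddCircle) = ((j / k : ℝ) : UnitAddCircle) := by
  rcases eq_or_ne k 0 with rfl | hk
  · simp
  have : NeZero k := ⟨hk⟩
  rw [← ZMod.toAddCircle_natCast, ← ZMod.toAddCircle_natCast,
    (ZMod.natCast_eq_natCast_iff _ _ _).2 h]

theorem pow_apply_eq_pow_apply_iff_modEq {i j : ℕ} {x : α} :
    (w ^ i) x = (w ^ j) x ↔ i ≡ j [MOD minimalPeriod w x] := by
  rw [Nat.modEq_iff_dvd]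
  refine Iff.trans ?_ (MulAction.zpow_smul_eq_iff_minimalPeriod_dvd (a := w) (b := x))
  rw [sub_eq_neg_add, zpow_add, mul_smul, zpow_neg, inv_smul_eq_iff, eq_comm, zpow_natCast,
    zpow_natCast, Perm.smul_def, Perm.smul_def]

theorem minimalPeriod_congr {β : Type*} {v : Perm β} {x : α} {y : β}
    (h : ∀ n : ℕ, (w ^ n) x = x ↔ (v ^ n) y = y) : minimalPeriod w x = minimalPeriod v y :=
  minimalPeriod_eq_minimalPeriod_iff.2 fun n => by
    simpa only [IsPeriodicPt, IsFixedPt, Perm.iterate_eq_pow] using h n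

theorem minimalPeriod_conj_apply (g w : Perm α) (x : α) :
    minimalPeriod (g * w * g⁻¹) (g x) = minimalPeriod w x :=
  minimalPeriod_congr fun n => by simp [conj_pow]

theorem IsPhase.comp_of_conj {ψ : α → UnitAddCircle} (hψ : IsPhase (g * w * g⁻¹) ψ) :
    IsPhase w (ψ ∘ g) := fun x => by
  have hx := hψ (g x)
  rwa [minimalPeriod_conj_apply, Perm.mul_apply, Perm.mul_apply, Perm.inv_def,
    symm_apply_apply] at hx

theorem exists_cycle_representative (w : Perm α) :
    ∃ base : α → α, (∀ x, w.SameCycle (base x) x) ∧ ∀ x y, w.SameCycle x y → base x = base y :=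
  ⟨fun x => (Quotient.mk (Perm.SameCycle.setoid w) x).out,
    fun x => Quotient.mk_out (s := Perm.SameCycle.setoid w) x,
    fun _ _ h => congrArg Quotient.out (Quotient.sound h)⟩

variable [Finite α]

theorem minimalPeriod_perm_pos (w : Perm α) (x : α) : 0 < minimalPeriod w x :=
  minimalPeriod_pos_of_mem_periodicPts (w.injective.mem_periodicPts x)

theorem minimalPeriod_eq_of_sameCycle {x y : α} (h : w.SameCycle x y) :
    minimalPeriod w x = minimalPeriod w y := by
  obtain ⟨i, rfl⟩ := h.exists_nat_pow_eq
  rw [← Perm.iterate_eq_pow, minimalPeriod_apply_iterate (w.injective.mem_periodicPts x)]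

theorem exists_isPhase (w : Perm α) : ∃ θ, IsPhase w θ := by
  obtain ⟨base, sameCycle_base, base_eq⟩ := exists_cycle_representative w
  have base_apply (x : α) : base (w x) = base x :=
    base_eq _ _ (Perm.sameCycle_apply_left.2 (Perm.SameCycle.refl w x))
  choose i hi using fun x => (sameCycle_base x).exists_nat_pow_eq
  refine ⟨fun x => ((i x / minimalPeriod w x : ℝ) : UnitAddCircle), fun x => ?_⟩
  have index_apply : i (w x) ≡ i x + 1 [MOD minimalPeriod w x] := by
    rw [← minimalPeriod_eq_of_sameCycle (sameCycle_base x), ← pow_apply_eq_pow_apply_iff_modEq,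
      ← base_apply, hi, base_apply, pow_succ', Perm.mul_apply, hi]
  beta_reduce
  rw [← minimalPeriod_eq_of_sameCycle (Perm.sameCycle_apply_right.2 (Perm.SameCycle.refl w x)),
    coe_natCast_div_eq_of_modEq index_apply, ← AddCircle.coe_add, Nat.cast_succ, add_div]

theorem IsPhase.pow_apply {θ : α → UnitAddCircle} (hθ : IsPhase w θ) (n : ℕ) (x : α) :
    θ ((w ^ n) x) = θ x + ((n / minimalPeriod w x : ℝ) : UnitAddCircle) := by
  induction n with
  | zero => simp
  | succ n ih =>
    have hperiod := minimalPeriod_eq_of_sameCycle ((Perm.SameCycle.refl w x).pow_right (n := n))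
    rw [pow_succ', Perm.mul_apply, hθ, ← hperiod, ih, add_assoc, ← AddCircle.coe_add,
      Nat.cast_succ, add_div]

theorem IsPhase.sub_apply_eq_of_sameCycle {θ ψ : α → UnitAddCircle} (hθ : IsPhase w θ)
    (hψ : IsPhase w ψ) {x y : α} (h : w.SameCycle x y) : ψ x - θ x = ψ y - θ y := by
  obtain ⟨n, rfl⟩ := h.exists_nat_pow_eq
  rw [hθ.pow_apply, hψ.pow_apply, add_sub_add_right_eq_sub]

end Phase

section Transversal

variable {α : Type*} {g w : Perm α} {S : Set α} {T T' : Finset α}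

/-- `T` contains exactly one point of each cycle of `w` meeting `S`, and is contained in `S`.
Only the case where `S` is a union of cycles is of interest. -/
structure IsCycleTransversal (w : Perm α) (S : Set α) (T : Finset α) : Prop where
  mem_of_mem : ∀ t ∈ T, t ∈ S
  exists_mem : ∀ x ∈ S, ∃ t ∈ T, w.SameCycle x t
  eq_of_sameCycle : ∀ s ∈ T, ∀ t ∈ T, w.SameCycle s t → s = t

theorem exists_isCycleTransversal [Finite α] (hS : ∀ x y, w.SameCycle x y → x ∈ S → y ∈ S) :
    ∃ T, IsCycleTransversal w S T := by
  classical
  have := Fintype.ofFinite α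
  obtain ⟨base, sameCycle_base, base_eq⟩ := exists_cycle_representative w
  refine ⟨Finset.univ.filter fun t => t ∈ S ∧ base t = t, ?_,
    fun x hx => ⟨base x, ?_, (sameCycle_base x).symm⟩, ?_⟩
  · simp +contextual
  · simpa using ⟨hS _ _ (sameCycle_base x).symm hx, base_eq _ _ (sameCycle_base x)⟩
  · simp only [Finset.mem_filter, Finset.mem_univ, true_and]
    rintro s ⟨-, hs⟩ t ⟨-, ht⟩ h
    rw [← hs, ← ht, base_eq s t h]

theorem IsCycleTransversal.sum_eq {M : Type*} [AddCommMonoid M] (hT : IsCycleTransversal w S T)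
    (hT' : IsCycleTransversal w S T') {f : α → M} (hf : ∀ x y, w.SameCycle x y → f x = f y) :
    ∑ t ∈ T, f t = ∑ t ∈ T', f t := by
  choose! i hi hi' using hT'.exists_mem
  refine Finset.sum_bij (fun x _ => i x) (fun x hx => hi x (hT.mem_of_mem x hx))
    (fun x hx y hy h => ?_) (fun t ht => ?_) (fun x hx => hf _ _ (hi' x (hT.mem_of_mem x hx)))
  · have hyi := hi' y (hT.mem_of_mem y hy)
    exact hT.eq_of_sameCycle x hx y hy ((hi' x (hT.mem_of_mem x hx)).trans (h ▸ hyi.symm))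
  · obtain ⟨s, hs, hts⟩ := hT.exists_mem t (hT'.mem_of_mem t ht)
    have hsS := hT.mem_of_mem s hs
    exact ⟨s, hs, hT'.eq_of_sameCycle _ (hi s hsS) _ ht (hts.trans (hi' s hsS)).symm⟩

theorem IsCycleTransversal.union_compl [DecidableEq α] (hT : IsCycleTransversal w S T)
    (hT' : IsCycleTransversal w Sᶜ T') (hS : ∀ x y, w.SameCycle x y → x ∈ S → y ∈ S) :
    IsCycleTransversal w Set.univ (T ∪ T') where
  mem_of_mem _ _ := Set.mem_univ _
  exists_mem x _ := by
    by_cases hx : x ∈ S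
    · obtain ⟨t, ht, h⟩ := hT.exists_mem x hx
      exact ⟨t, Finset.mem_union_left _ ht, h⟩
    · obtain ⟨t, ht, h⟩ := hT'.exists_mem x hx
      exact ⟨t, Finset.mem_union_right _ ht, h⟩
  eq_of_sameCycle s hs t ht h := by
    rcases Finset.mem_union.1 hs with hs | hs <;> rcases Finset.mem_union.1 ht with ht | ht
    · exact hT.eq_of_sameCycle s hs t ht h
    · exact absurd (hS s t h (hT.mem_of_mem s hs)) (hT'.mem_of_mem t ht)
    · exact absurd (hS t s h.symm (hT.mem_of_mem t ht)) (hT'.mem_of_mem s hs)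
    · exact hT'.eq_of_sameCycle s hs t ht h

theorem IsCycleTransversal.map_conj (hT : IsCycleTransversal w Set.univ T) (g : Perm α) :
    IsCycleTransversal (g * w * g⁻¹) Set.univ (T.map g.toEmbedding) where
  mem_of_mem _ _ := Set.mem_univ _
  exists_mem x _ := by
    obtain ⟨t, ht, h⟩ := hT.exists_mem (g⁻¹ x) (Set.mem_univ _)
    exact ⟨g t, Finset.mem_map_of_mem _ ht, by simpa using h.conj (g := g)⟩
  eq_of_sameCycle := by
    simp only [Finset.forall_mem_map, Equiv.coe_toEmbedding]
    intro s hs t ht h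
    rw [Perm.sameCycle_conj, Perm.inv_def, symm_apply_apply, symm_apply_apply] at h
    rw [hT.eq_of_sameCycle s hs t ht h]

end Transversal

section PhaseCocycle

variable {α : Type*} [Finite α] {g w : Perm α}

/-- A choice of phase for each permutation. -/
noncomputable def phase (w : Perm α) : α → UnitAddCircle := (exists_isPhase w).choose

theorem isPhase_phase (w : Perm α) : IsPhase w (phase w) := (exists_isPhase w).choose_spec

/-- A choice of one point on each cycle of a permutation. -/
noncomputable def cycleTransversal (w : Perm α) : Finset α :=
  (exists_isCycleTransversal (w := w) (S := Set.univ) fun _ y _ _ => Set.mem_univ y).choose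

theorem isCycleTransversal_cycleTransversal (w : Perm α) :
    IsCycleTransversal w Set.univ (cycleTransversal w) :=
  (exists_isCycleTransversal (w := w) (S := Set.univ) fun _ y _ _ => Set.mem_univ y).choose_spec

/-- The amount by which `g`, carrying the cycles of `w` to those of its conjugate `g * w * g⁻¹`,
rotates them against the chosen phases, summed over the cycles of `w`. It is an additive cocycle
for the conjugation action. On the centralizer of `w`, a product of wreath products `C_k ≀ S_m`, it
is the homomorphism to `ℝ / ℤ` that adds up the `C_k = (1 / k) ℤ / ℤ` components. -/
noncomputable def phaseCocycle (g w : Perm α) : UnitAddCircle :=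
  ∑ t ∈ cycleTransversal w, (phase (g * w * g⁻¹) (g t) - phase w t)

theorem phaseCocycle_eq_sum {T : Finset α} (hT : IsCycleTransversal w Set.univ T) (g : Perm α) :
    phaseCocycle g w = ∑ t ∈ T, (phase (g * w * g⁻¹) (g t) - phase w t) :=
  (isCycleTransversal_cycleTransversal w).sum_eq hT fun _ _ =>
    (isPhase_phase w).sub_apply_eq_of_sameCycle (isPhase_phase (g * w * g⁻¹)).comp_of_conj

theorem phaseCocycle_one (w : Perm α) : phaseCocycle 1 w = 0 :=
  Finset.sum_eq_zero fun t _ => by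
    rw [one_mul, inv_one, mul_one, Perm.one_apply, sub_self]

theorem phaseCocycle_mul (g h w : Perm α) :
    phaseCocycle (g * h) w = phaseCocycle g (h * w * h⁻¹) + phaseCocycle h w := by
  rw [phaseCocycle_eq_sum ((isCycleTransversal_cycleTransversal w).map_conj h), Finset.sum_map,
    phaseCocycle, phaseCocycle, ← Finset.sum_add_distrib]
  refine Finset.sum_congr rfl fun t _ => ?_
  simp only [Equiv.coe_toEmbedding, Perm.mul_apply, mul_inv_rev, mul_assoc, sub_add_sub_cancel]

theorem phaseCocycle_pow (hgw : Commute g w) (m : ℕ) :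
    phaseCocycle (g ^ m) w = m • phaseCocycle g w := by
  induction m with
  | zero => rw [pow_zero, phaseCocycle_one, zero_nsmul]
  | succ m ih =>
    rw [pow_succ, phaseCocycle_mul, hgw.eq, mul_inv_cancel_right, ih, succ_nsmul]

/-- Two phases of `w` differ by a function on the cycles, which `g` permutes. -/
theorem phaseCocycle_eq_sum_of_commute (hgw : Commute g w) {θ : α → UnitAddCircle}
    (hθ : IsPhase w θ) {T : Finset α} (hT : IsCycleTransversal w Set.univ T) :
    phaseCocycle g w = ∑ t ∈ T, (θ (g t) - θ t) := by
  have hconj : g * w * g⁻¹ = w := by rw [hgw.eq, mul_inv_cancel_right]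
  have hgT : IsCycleTransversal w Set.univ (T.map g.toEmbedding) := by
    simpa only [hconj] using hT.map_conj g
  have hsum : ∑ t ∈ T, (phase w t - θ t) = ∑ t ∈ T, (phase w (g t) - θ (g t)) := by
    rw [hT.sum_eq hgT fun _ _ => hθ.sub_apply_eq_of_sameCycle (isPhase_phase w), Finset.sum_map]
    rfl
  rw [phaseCocycle_eq_sum hT, hconj, ← sub_eq_zero, ← Finset.sum_sub_distrib,
    ← sub_eq_zero.2 hsum.symm, ← Finset.sum_sub_distrib]
  exact Finset.sum_congr rfl fun t _ => by abel

end PhaseCocycle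

section Agree

variable {α : Type*} {g v w : Perm α} {S : Set α}

theorem pow_apply_eq_of_eqOn_compl (hvS : ∀ y z, v.SameCycle y z → y ∈ S → z ∈ S)
    (hvw : Set.EqOn v w Sᶜ) (n : ℕ) {y : α} (hy : y ∉ S) : (v ^ n) y = (w ^ n) y := by
  induction n with
  | zero => rfl
  | succ n ih =>
    have hn : (v ^ n) y ∉ S := fun h =>
      hy (hvS _ _ (Perm.sameCycle_pow_left.2 (Perm.SameCycle.refl v y)) h)
    rw [pow_succ', pow_succ', Perm.mul_apply, Perm.mul_apply, hvw hn, ih]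

open Classical in
theorem IsPhase.piecewise_of_eqOn_compl {θ ψ : α → UnitAddCircle} (hψ : IsPhase v ψ)
    (hθ : IsPhase w θ) (hvS : ∀ y z, v.SameCycle y z → y ∈ S → z ∈ S)
    (hvw : Set.EqOn v w Sᶜ) : IsPhase v (S.piecewise ψ θ) := fun y => by
  have hy := Perm.sameCycle_apply_right.2 (Perm.SameCycle.refl v y)
  by_cases hyS : y ∈ S
  · rw [Set.piecewise_eq_of_mem _ _ _ hyS, Set.piecewise_eq_of_mem _ _ _ (hvS _ _ hy hyS), hψ]
  · have hperiod : minimalPeriod v y = minimalPeriod w y := minimalPeriod_congr fun n => by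
      rw [pow_apply_eq_of_eqOn_compl hvS hvw n hyS]
    rw [Set.piecewise_eq_of_notMem _ _ _ hyS,
      Set.piecewise_eq_of_notMem _ _ _ fun h => hyS (hvS _ _ hy.symm h), hvw hyS, hθ, hperiod]

variable [Finite α]

theorem sameCycle_iff_of_eqOn_compl (hvS : ∀ y z, v.SameCycle y z → y ∈ S → z ∈ S)
    (hvw : Set.EqOn v w Sᶜ) {y z : α} (hy : y ∉ S) : v.SameCycle y z ↔ w.SameCycle y z := by
  have hpow (n : ℕ) := pow_apply_eq_of_eqOn_compl hvS hvw n hy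
  constructor <;> intro h <;> obtain ⟨n, rfl⟩ := h.exists_nat_pow_eq
  · exact hpow n ▸ Perm.sameCycle_pow_right.2 (Perm.SameCycle.refl w y)
  · exact hpow n ▸ Perm.sameCycle_pow_right.2 (Perm.SameCycle.refl v y)

theorem IsCycleTransversal.of_eqOn_compl {T : Finset α} (hT : IsCycleTransversal w Sᶜ T)
    (hvS : ∀ y z, v.SameCycle y z → y ∈ S → z ∈ S) (hvw : Set.EqOn v w Sᶜ) :
    IsCycleTransversal v Sᶜ T where
  mem_of_mem := hT.mem_of_mem
  exists_mem y hy := by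
    simpa only [sameCycle_iff_of_eqOn_compl hvS hvw hy] using hT.exists_mem y hy
  eq_of_sameCycle s hs t ht h := hT.eq_of_sameCycle s hs t ht <|
    (sameCycle_iff_of_eqOn_compl hvS hvw (hT.mem_of_mem s hs)).1 h

theorem phaseCocycle_eq_sum_add_sum (hgv : Commute g v) (hgS : ∀ y, g y ∈ S ↔ y ∈ S)
    (hvS : ∀ y z, v.SameCycle y z → y ∈ S → z ∈ S) (hvw : Set.EqOn v w Sᶜ)
    {θ ψ : α → UnitAddCircle} (hψ : IsPhase v ψ) (hθ : IsPhase w θ) {T T' : Finset α}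
    (hT : IsCycleTransversal v S T) (hT' : IsCycleTransversal w Sᶜ T') :
    phaseCocycle g v = ∑ t ∈ T, (ψ (g t) - ψ t) + ∑ t ∈ T', (θ (g t) - θ t) := by
  classical
  have hdisjoint : Disjoint T T' := Finset.disjoint_left.2 fun t ht ht' =>
    hT'.mem_of_mem t ht' (hT.mem_of_mem t ht)
  rw [phaseCocycle_eq_sum_of_commute hgv (hψ.piecewise_of_eqOn_compl hθ hvS hvw)
    (hT.union_compl (hT'.of_eqOn_compl hvS hvw) hvS), Finset.sum_union hdisjoint]
  congr 1 <;> refine Finset.sum_congr rfl fun t ht => ?_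
  · have htS := hT.mem_of_mem t ht
    rw [Set.piecewise_eq_of_mem _ _ _ htS, Set.piecewise_eq_of_mem _ _ _ ((hgS t).2 htS)]
  · have htS := hT'.mem_of_mem t ht
    rw [Set.piecewise_eq_of_notMem _ _ _ htS,
      Set.piecewise_eq_of_notMem _ _ _ fun h => htS ((hgS t).1 h)]

end Agree

section CommutingPair

variable {α : Type*} {g v w : Perm α} {x : α}

theorem pow_apply_pow_apply_comm (hgw : Commute g w) (m n : ℕ) (x : α) :
    (g ^ m) ((w ^ n) x) = (w ^ n) ((g ^ m) x) := by
  rw [← Perm.mul_apply, ← Perm.mul_apply, (hgw.pow_pow m n).eq]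

theorem sameCycle_pow_apply_iff (hgw : Commute g w) (n : ℕ) {x y : α} :
    g.SameCycle ((w ^ n) x) ((w ^ n) y) ↔ g.SameCycle x y := by
  have hconj : w ^ n * g * (w ^ n)⁻¹ = g := by
    rw [← (hgw.pow_right n).eq, mul_inv_cancel_right]
  simpa [hconj] using Perm.sameCycle_conj (f := g) (g := w ^ n) (x := (w ^ n) x) (y := (w ^ n) y)

/-- `b` is the length of the orbit of the cycle of `x` under the action of `w` on the cycles
of `g`. -/
theorem exists_sameCycle_pow_apply_iff_dvd [Finite α] (hgw : Commute g w) (x : α) :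
    ∃ b : ℕ, 0 < b ∧ ∀ n, g.SameCycle x ((w ^ n) x) ↔ b ∣ n := by
  let toCycle : α → Quotient (Perm.SameCycle.setoid g) := Quotient.mk _
  let wbar : Quotient (Perm.SameCycle.setoid g) → Quotient (Perm.SameCycle.setoid g) :=
    Quotient.map w fun y z h => (pow_one w ▸ sameCycle_pow_apply_iff hgw 1).2 h
  have hsemiconj : Semiconj toCycle w wbar := fun _ => rfl
  have hperiodic (n : ℕ) : IsPeriodicPt wbar n (toCycle x) ↔ g.SameCycle x ((w ^ n) x) := by
    rw [IsPeriodicPt, IsFixedPt, ← hsemiconj.iterate_right n x, Perm.iterate_eq_pow]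
    exact Quotient.eq.trans Perm.sameCycle_comm
  refine ⟨minimalPeriod wbar (toCycle x), ?_, fun n => ?_⟩
  · refine IsPeriodicPt.minimalPeriod_pos (orderOf_pos w) ((hperiodic _).2 ?_)
    rw [pow_orderOf_eq_one]
    exact Perm.SameCycle.refl g x
  · rw [← hperiodic, isPeriodicPt_iff_minimalPeriod_dvd]

theorem sameCycle_pow_apply_pow_apply_iff_modEq (hgv : Commute g v) {j : ℕ}
    (hj : ∀ n, v.SameCycle x ((g ^ n) x) ↔ j ∣ n) (s t : ℕ) :
    v.SameCycle ((g ^ s) x) ((g ^ t) x) ↔ s ≡ t [MOD j] := by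
  wlog hst : s ≤ t generalizing s t
  · rw [Perm.sameCycle_comm, this t s (le_of_not_ge hst), Nat.ModEq.comm]
  have htg : (g ^ t) x = (g ^ s) ((g ^ (t - s)) x) := by
    rw [← Perm.mul_apply, ← pow_add, Nat.add_sub_cancel' hst]
  rw [Nat.modEq_iff_dvd' hst, ← hj, htg, sameCycle_pow_apply_iff hgv.symm]

/-- The orbit of `x` under the group generated by two commuting permutations `g` and `w` of a
finite set. -/
def commOrbit (g w : Perm α) (x : α) : Set α := {y | ∃ n : ℕ, g.SameCycle ((w ^ n) x) y}

theorem apply_mem_commOrbit_iff {y : α} : g y ∈ commOrbit g w x ↔ y ∈ commOrbit g w x :=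
  exists_congr fun _ => Perm.sameCycle_apply_right

theorem mem_commOrbit_of_sameCycle [Finite α] (hgw : Commute g w) (y z : α)
    (h : w.SameCycle y z) (hy : y ∈ commOrbit g w x) : z ∈ commOrbit g w x := by
  obtain ⟨m, rfl⟩ := h.exists_nat_pow_eq
  obtain ⟨n, hn⟩ := hy
  refine ⟨m + n, ?_⟩
  rwa [pow_add, Perm.mul_apply, sameCycle_pow_apply_iff hgw]

theorem sameCycle_pow_apply_pow_apply (hgw : Commute g w)
    (hwv : ∀ y, g.SameCycle (w y) (v y)) (n : ℕ) (y : α) :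
    g.SameCycle ((w ^ n) y) ((v ^ n) y) := by
  induction n with
  | zero => exact Perm.SameCycle.refl g y
  | succ n ih =>
    rw [pow_succ', pow_succ', Perm.mul_apply, Perm.mul_apply]
    exact ((pow_one w ▸ sameCycle_pow_apply_iff hgw 1).2 ih).trans (hwv _)

theorem commOrbit_eq_of_sameCycle (hgw : Commute g w) (hwv : ∀ y, g.SameCycle (w y) (v y)) :
    commOrbit g v x = commOrbit g w x :=
  Set.ext fun _ => exists_congr fun n =>
    ⟨(sameCycle_pow_apply_pow_apply hgw hwv n x).trans,
      (sameCycle_pow_apply_pow_apply hgw hwv n x).symm.trans⟩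

theorem isCycleTransversal_commOrbit [Finite α] [DecidableEq α] (hgv : Commute g v) {j : ℕ}
    (hj0 : 0 < j) (hj : ∀ n, v.SameCycle x ((g ^ n) x) ↔ j ∣ n) :
    IsCycleTransversal v (commOrbit g v x) ((Finset.range j).image fun t => (g ^ t) x) where
  mem_of_mem := by
    simp only [Finset.forall_mem_image]
    exact fun t _ => ⟨0, Perm.sameCycle_pow_right.2 (Perm.SameCycle.refl g x)⟩
  exists_mem := by
    rintro _ ⟨n, hn⟩
    obtain ⟨s, rfl⟩ := hn.exists_nat_pow_eq
    refine ⟨_, Finset.mem_image_of_mem _ (Finset.mem_range.2 (Nat.mod_lt s hj0)), ?_⟩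
    rw [pow_apply_pow_apply_comm hgv, Perm.sameCycle_pow_left,
      sameCycle_pow_apply_pow_apply_iff_modEq hgv hj]
    exact (Nat.mod_modEq s j).symm
  eq_of_sameCycle := by
    simp only [Finset.forall_mem_image, Finset.mem_range]
    intro s hs t ht h
    rw [sameCycle_pow_apply_pow_apply_iff_modEq hgv hj] at h
    rw [h.eq_of_lt_of_lt hs ht]

theorem sum_image_pow_apply_sub [DecidableEq α] {M : Type*} [AddCommGroup M] (hgv : Commute g v)
    {j : ℕ} (hj : ∀ n, v.SameCycle x ((g ^ n) x) ↔ j ∣ n) (θ : α → M) :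
    ∑ t ∈ (Finset.range j).image (fun t => (g ^ t) x), (θ (g t) - θ t) = θ ((g ^ j) x) - θ x := by
  rw [Finset.sum_image]
  · simpa only [← Perm.mul_apply, ← pow_succ', pow_zero, Perm.one_apply] using
      Finset.sum_range_sub (fun t => θ ((g ^ t) x)) j
  · intro s hs t ht (hst : (g ^ s) x = (g ^ t) x)
    have h : s ≡ t [MOD j] := (sameCycle_pow_apply_pow_apply_iff_modEq hgv hj s t).1
      (hst ▸ Perm.SameCycle.refl v _)
    exact h.eq_of_lt_of_lt (Finset.mem_range.1 hs) (Finset.mem_range.1 ht)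

end CommutingPair

section ReturnMap

variable {α : Type*} {g v : Perm α} {x : α} {b j u : ℕ}

theorem pow_mul_apply_eq (hgv : Commute g v) (hu : (v ^ b) x = (g ^ u) x) (n : ℕ) :
    (v ^ (b * n)) x = (g ^ (u * n)) x := by
  induction n with
  | zero => rfl
  | succ n ih =>
    rw [Nat.mul_succ, Nat.mul_succ, pow_add, pow_add, Perm.mul_apply, Perm.mul_apply, hu,
      ← pow_apply_pow_apply_comm hgv, ih, ← Perm.mul_apply, ← Perm.mul_apply,
      (Commute.refl g).pow_pow]

theorem pow_mul_apply_eq_pow_apply_iff (hgv : Commute g v) (hu : (v ^ b) x = (g ^ u) x)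
    {m n : ℕ} : (v ^ (b * m)) x = (g ^ n) x ↔ (u : ZMod (minimalPeriod g x)) * m = n := by
  rw [pow_mul_apply_eq hgv hu, pow_apply_eq_pow_apply_iff_modEq, ← ZMod.natCast_eq_natCast_iff,
    Nat.cast_mul]

theorem sameCycle_pow_apply_iff_natCast_dvd [Finite α] (hgv : Commute g v)
    (hb : ∀ n, g.SameCycle x ((v ^ n) x) ↔ b ∣ n) (hu : (v ^ b) x = (g ^ u) x) (n : ℕ) :
    v.SameCycle x ((g ^ n) x) ↔ (u : ZMod (minimalPeriod g x)) ∣ n := by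
  have : NeZero (minimalPeriod g x) := ⟨(minimalPeriod_perm_pos g x).ne'⟩
  constructor
  · intro h
    obtain ⟨N, hN⟩ := h.exists_nat_pow_eq
    obtain ⟨m, rfl⟩ := (hb N).1 (hN ▸ Perm.sameCycle_pow_right.2 (Perm.SameCycle.refl g x))
    exact ⟨m, ((pow_mul_apply_eq_pow_apply_iff hgv hu).1 hN).symm⟩
  · rintro ⟨m, hm⟩
    rw [← ZMod.natCast_zmod_val m, eq_comm] at hm
    rw [← (pow_mul_apply_eq_pow_apply_iff hgv hu).2 hm]
    exact Perm.sameCycle_pow_right.2 (Perm.SameCycle.refl v x)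

theorem natCast_mul_eq_zero_iff {d : ℕ} (hj : ∀ n : ℕ, j ∣ n ↔ (u : ZMod d) ∣ n) (n : ZMod d) :
    u * n = 0 ↔ j * n = 0 := by
  obtain ⟨a, ha⟩ := (hj u).2 dvd_rfl
  obtain ⟨m, hm⟩ := (hj j).1 dvd_rfl
  constructor <;> intro h
  · rw [hm, mul_right_comm, h, zero_mul]
  · rw [ha, Nat.cast_mul, mul_right_comm, h, zero_mul]

theorem minimalPeriod_mul_eq_mul_minimalPeriod [Finite α] (hgv : Commute g v)
    (hb : ∀ n, g.SameCycle x ((v ^ n) x) ↔ b ∣ n) (hu : (v ^ b) x = (g ^ u) x)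
    (hj : ∀ n : ℕ, j ∣ n ↔ (u : ZMod (minimalPeriod g x)) ∣ n) :
    minimalPeriod v x * j = b * minimalPeriod g x := by
  have hperiodic (n : ℕ) : minimalPeriod v x ∣ n ↔ (v ^ n) x = x := by
    rw [← isPeriodicPt_iff_minimalPeriod_dvd, IsPeriodicPt, IsFixedPt, Perm.iterate_eq_pow]
  obtain ⟨l, hl⟩ : b ∣ minimalPeriod v x :=
    (hb _).1 (((hperiodic _).1 dvd_rfl).symm ▸ Perm.SameCycle.refl g x)
  obtain ⟨k, hk⟩ : j ∣ minimalPeriod g x :=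
    (hj _).2 (by rw [ZMod.natCast_self]; exact dvd_zero _)
  have hb0 : 0 < b := Nat.pos_of_mul_pos_right (hl ▸ minimalPeriod_perm_pos v x)
  have hj0 : 0 < j := Nat.pos_of_mul_pos_right (hk ▸ minimalPeriod_perm_pos g x)
  have hlk : l = k := Nat.dvd_right_iff_eq.1 fun n => by
    rw [← mul_dvd_mul_iff_left hb0.ne', ← hl, hperiodic,
      show (v ^ (b * n)) x = x ↔ _ from pow_mul_apply_eq_pow_apply_iff (n := 0) hgv hu,
      Nat.cast_zero, natCast_mul_eq_zero_iff hj, ← Nat.cast_mul, ZMod.natCast_eq_zero_iff]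
    conv_lhs => rw [hk]
    rw [mul_dvd_mul_iff_left hj0.ne']
  rw [hl, hk, hlk, mul_assoc, mul_comm k]

theorem IsPhase.pow_apply_sub_apply_eq_toAddCircle [Finite α] [NeZero (minimalPeriod g x)]
    {θ : α → UnitAddCircle} (hθ : IsPhase v θ) (hgv : Commute g v)
    (hb : ∀ n, g.SameCycle x ((v ^ n) x) ↔ b ∣ n) (hu : (v ^ b) x = (g ^ u) x)
    (hj : ∀ n : ℕ, j ∣ n ↔ (u : ZMod (minimalPeriod g x)) ∣ n) {m : ZMod (minimalPeriod g x)}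
    (hm : u * m = j) :
    θ ((g ^ j) x) - θ x = ZMod.toAddCircle (m * (j : ZMod (minimalPeriod g x))) := by
  have hperiod := minimalPeriod_mul_eq_mul_minimalPeriod hgv hb hu hj
  rw [← ZMod.natCast_zmod_val m] at hm ⊢
  rw [← (pow_mul_apply_eq_pow_apply_iff hgv hu).2 hm, hθ.pow_apply, add_sub_cancel_left,
    ← Nat.cast_mul, ZMod.toAddCircle_natCast]
  congr 1
  rw [div_eq_div_iff (Nat.cast_ne_zero.2 (minimalPeriod_perm_pos v x).ne')
    (Nat.cast_ne_zero.2 (minimalPeriod_perm_pos g x).ne')]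
  norm_cast
  rw [mul_right_comm, ← hperiod]
  ring

theorem eq_of_mul_natCast_eq {d j' : ℕ} [NeZero d] {u u' m m' : ZMod d}
    (hj : ∀ n : ℕ, j ∣ n ↔ u ∣ n) (hj' : ∀ n : ℕ, j' ∣ n ↔ u' ∣ n) (hm : u * m = j)
    (hm' : u' * m' = j') (hmj : m * j = m' * j') : u = u' := by
  obtain ⟨a, ha⟩ : (j : ZMod d) ∣ u := by
    simpa using Nat.cast_dvd_cast (α := ZMod d) ((hj u.val).2 (by simp))
  obtain ⟨a', ha'⟩ : (j' : ZMod d) ∣ u' := by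
    simpa using Nat.cast_dvd_cast (α := ZMod d) ((hj' u'.val).2 (by simp))
  have hz' : a' * (m' * j') = j' := by linear_combination hm' - m' * ha'
  have hz : a * (m * j) = j := by linear_combination hm - m * ha
  -- `m * j` generates the same ideal of `ZMod d` as `j` and `u`, so it determines `j`.
  have hjj' : j = j' := Nat.dvd_antisymm
    ((hj j').2 ⟨a' * m * m, by linear_combination -hz' - a' * hmj - a' * m * hm⟩)
    ((hj' j).2 ⟨a * m' * m', by linear_combination -hz + a * hmj - a * m' * hm'⟩)
  subst hjj'
  linear_combination ha - ha' - a * hz' + a' * hz - a * a' * hmj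

end ReturnMap

section CycleTranslation

variable {α : Type*} {g w : Perm α} [DecidableRel g.SameCycle] {x y : α}

theorem cycleOf_pow_apply_of_sameCycle (h : g.SameCycle x y) (i : ℕ) :
    (g.cycleOf x ^ i) y = (g ^ i) y := by
  rw [h.cycleOf_eq, Perm.cycleOf_pow_apply_self]

theorem cycleOf_pow_apply_of_not_sameCycle (h : ¬ g.SameCycle x y) (i : ℕ) :
    (g.cycleOf x ^ i) y = y :=
  IsFixedPt.perm_pow (e := g.cycleOf x) (Perm.cycleOf_apply_of_not_sameCycle h) i

theorem commute_cycleOf (g : Perm α) [DecidableRel g.SameCycle] (x : α) :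
    Commute g (g.cycleOf x) := by
  ext y
  rw [Perm.mul_apply, Perm.mul_apply]
  by_cases h : g.SameCycle x y
  · rw [h.cycleOf_apply, h.apply_right.cycleOf_apply]
  · rw [Perm.cycleOf_apply_of_not_sameCycle h,
      Perm.cycleOf_apply_of_not_sameCycle (by rwa [Perm.sameCycle_apply_right])]

theorem sameCycle_cycleOf_pow_apply (g : Perm α) [DecidableRel g.SameCycle] (x : α) (i : ℕ)
    (y : α) : g.SameCycle y ((g.cycleOf x ^ i) y) := by
  by_cases h : g.SameCycle x y
  · rw [cycleOf_pow_apply_of_sameCycle h]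
    exact Perm.SameCycle.rfl.pow_right
  · rw [cycleOf_pow_apply_of_not_sameCycle h]

theorem sameCycle_apply_mul_cycleOf_pow_apply (hgw : Commute g w) (x : α) (i : ℕ) (y : α) :
    g.SameCycle (w y) ((w * g.cycleOf x ^ i) y) := by
  simpa only [pow_one, Perm.mul_apply] using
    (sameCycle_pow_apply_iff hgw 1).2 (sameCycle_cycleOf_pow_apply g x i y)

theorem eqOn_mul_cycleOf_pow_compl_commOrbit (g w : Perm α) [DecidableRel g.SameCycle] (x : α)
    (i : ℕ) : Set.EqOn (w * g.cycleOf x ^ i) w (commOrbit g w x)ᶜ := fun y hy => by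
  have hxy : ¬ g.SameCycle x y := fun h => hy ⟨0, h⟩
  rw [Perm.mul_apply, cycleOf_pow_apply_of_not_sameCycle hxy]

/-- Until it returns to the cycle of `x`, the path of `x` meets the extra factor only once. -/
theorem mul_cycleOf_pow_pow_apply {b c : ℕ} (hgw : Commute g w)
    (hb : ∀ n, g.SameCycle x ((w ^ n) x) ↔ b ∣ n) (hb0 : 0 < b) (hc : (w ^ b) x = (g ^ c) x)
    (i : ℕ) : ((w * g.cycleOf x ^ i) ^ b) x = (g ^ (c + i)) x := by
  have hpath (s : ℕ) (hs : s < b) :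
      ((w * g.cycleOf x ^ i) ^ (s + 1)) x = (w ^ (s + 1)) ((g ^ i) x) := by
    induction s with
    | zero => simp [Perm.cycleOf_pow_apply_self]
    | succ s ih =>
      have hoff : ¬ g.SameCycle x ((w ^ (s + 1)) ((g ^ i) x)) := by
        rw [← pow_apply_pow_apply_comm hgw, Perm.sameCycle_pow_right, hb]
        exact Nat.not_dvd_of_pos_of_lt s.succ_pos hs
      rw [pow_succ', Perm.mul_apply, ih (Nat.lt_of_succ_lt hs), Perm.mul_apply,
        cycleOf_pow_apply_of_not_sameCycle hoff, ← Perm.mul_apply, ← pow_succ']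
  obtain ⟨s, rfl⟩ := Nat.exists_eq_succ_of_ne_zero hb0.ne'
  rw [hpath s s.lt_succ_self, ← pow_apply_pow_apply_comm hgw, hc, ← Perm.mul_apply, ← pow_add,
    add_comm]

theorem exists_phaseCocycle_eq_add_toAddCircle [Finite α] [NeZero (minimalPeriod g x)]
    (hgw : Commute g w) : ∃ A : UnitAddCircle, ∃ c : ZMod (minimalPeriod g x), ∀ i : ℕ,
      ∃ (j : ℕ) (m : ZMod (minimalPeriod g x)),
        (∀ n : ℕ, j ∣ n ↔ (c + i : ZMod (minimalPeriod g x)) ∣ n) ∧ (c + i) * m = j ∧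
        phaseCocycle g (w * g.cycleOf x ^ i) =
          A + ZMod.toAddCircle (m * (j : ZMod (minimalPeriod g x))) := by
  classical
  obtain ⟨b, hb0, hb⟩ := exists_sameCycle_pow_apply_iff_dvd hgw x
  obtain ⟨c, hc⟩ := ((hb b).2 dvd_rfl).exists_nat_pow_eq
  obtain ⟨T, hT⟩ := exists_isCycleTransversal (w := w) (S := (commOrbit g w x)ᶜ)
    fun y z h hy hz => hy (mem_commOrbit_of_sameCycle hgw z y h.symm hz)
  refine ⟨∑ t ∈ T, (phase w (g t) - phase w t), c, fun i => ?_⟩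
  have hgv : Commute g (w * g.cycleOf x ^ i) :=
    hgw.mul_right ((commute_cycleOf g x).pow_right i)
  have hsameCycle := sameCycle_apply_mul_cycleOf_pow_apply hgw x i
  have horbit := commOrbit_eq_of_sameCycle (x := x) hgw hsameCycle
  have hbv (n : ℕ) : g.SameCycle x (((w * g.cycleOf x ^ i) ^ n) x) ↔ b ∣ n := by
    rw [← hb]
    have h := sameCycle_pow_apply_pow_apply hgw hsameCycle n x
    exact ⟨fun hx => hx.trans h.symm, fun hx => hx.trans h⟩
  have hu := mul_cycleOf_pow_pow_apply hgw hb hb0 hc.symm i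
  obtain ⟨j, hj0, hj⟩ := exists_sameCycle_pow_apply_iff_dvd hgv.symm x
  have hju (n : ℕ) := (hj n).symm.trans (sameCycle_pow_apply_iff_natCast_dvd hgv hbv hu n)
  obtain ⟨m, hm⟩ := (hju j).1 dvd_rfl
  refine ⟨j, m, by exact_mod_cast hju, by exact_mod_cast hm.symm, ?_⟩
  have hsplit := phaseCocycle_eq_sum_add_sum hgv (fun _ => apply_mem_commOrbit_iff)
    (mem_commOrbit_of_sameCycle (x := x) hgv)
    (horbit.symm ▸ eqOn_mul_cycleOf_pow_compl_commOrbit g w x i)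
    (isPhase_phase _) (isPhase_phase w) (isCycleTransversal_commOrbit hgv hj0 hj)
    (horbit.symm ▸ hT)
  rw [hsplit, sum_image_pow_apply_sub hgv hj, add_comm,
    (isPhase_phase _).pow_apply_sub_apply_eq_toAddCircle hgv hbv hu hju hm.symm]

theorem exists_bijective_phaseCocycle_eq [Finite α] [NeZero (minimalPeriod g x)]
    (hgw : Commute g w) :
    ∃ (A : UnitAddCircle) (e : ZMod (minimalPeriod g x) → ZMod (minimalPeriod g x)),
      Bijective e ∧ ∀ i : ZMod (minimalPeriod g x),
        phaseCocycle g (w * g.cycleOf x ^ i.val) = A + ZMod.toAddCircle (e i) := by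
  obtain ⟨A, c, h⟩ := exists_phaseCocycle_eq_add_toAddCircle (x := x) hgw
  choose j m hj hm hA using fun i : ZMod (minimalPeriod g x) => h i.val
  simp only [ZMod.natCast_val, ZMod.cast_id', id] at hj hm
  refine ⟨A, fun i => m i * j i, Finite.injective_iff_bijective.1 fun i i' hii' => ?_, hA⟩
  exact add_left_cancel (eq_of_mul_natCast_eq (hj i) (hj i') (hm i) (hm i') hii')

end CycleTranslation

section PhaseWeight

open AddCircle

variable {α : Type*} {g w : Perm α}

/-- The `r`-th power of the multiplicative form `exp (2 * π * I * phaseCocycle g w)` of the phase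
cocycle. -/
noncomputable def phaseWeight [Finite α] (r : ℕ) (g w : Perm α) : ℂ :=
  toCircle (r • phaseCocycle g w)

theorem phaseWeight_one [Finite α] (r : ℕ) (w : Perm α) : phaseWeight r 1 w = 1 := by
  rw [phaseWeight, phaseCocycle_one, smul_zero, toCircle_zero, Circle.coe_one]

theorem phaseWeight_mul [Finite α] (r : ℕ) (g h w : Perm α) :
    phaseWeight r (g * h) w = phaseWeight r g (h * w * h⁻¹) * phaseWeight r h w := by
  rw [phaseWeight, phaseCocycle_mul, smul_add, toCircle_add, Circle.coe_mul, phaseWeight,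
    phaseWeight]

theorem phaseWeight_eq_one_of_pow_eq_one [Finite α] {r : ℕ} (hgw : Commute g w) (hr : g ^ r = 1) :
    phaseWeight r g w = 1 := by
  rw [phaseWeight, ← phaseCocycle_pow hgw, hr, phaseCocycle_one, toCircle_zero, Circle.coe_one]

open Classical in
theorem sum_mul_of_commute {G M : Type*} [Group G] [Fintype G] [AddCommMonoid M] {g z : G}
    (hgz : Commute g z) (f : G → M) :
    ∑ w : G with Commute g w, f (w * z) = ∑ w : G with Commute g w, f w :=
  Finset.sum_equiv (Equiv.mulRight z) (fun w => by
    simp only [Finset.mem_filter, Finset.mem_univ, true_and, Equiv.coe_mulRight]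
    exact ⟨fun h => h.mul_right hgz, fun h => by simpa using h.mul_right hgz.inv_right⟩)
    fun _ _ => rfl

theorem sum_toCircle_nsmul_toAddCircle {d : ℕ} [NeZero d] {r : ℕ} (hr : ¬ d ∣ r) :
    ∑ z : ZMod d, (toCircle (r • ZMod.toAddCircle z) : ℂ) = 0 := by
  have hsum := AddChar.sum_mulShift (r : ZMod d) (ZMod.isPrimitive_stdAddChar d)
  rw [if_neg (by rwa [ZMod.natCast_eq_zero_iff])] at hsum
  rw [← Nat.cast_zero, ← hsum]
  refine Finset.sum_congr rfl fun z _ => ?_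
  rw [← map_nsmul, nsmul_eq_mul, mul_comm]
  rfl

theorem sum_phaseWeight_mul_cycleOf_pow_eq_zero [Finite α] [DecidableRel g.SameCycle]
    (hgw : Commute g w) {r : ℕ} {x : α} [NeZero (minimalPeriod g x)] (hx : (g ^ r) x ≠ x) :
    ∑ i : ZMod (minimalPeriod g x), phaseWeight r g (w * g.cycleOf x ^ i.val) = 0 := by
  have hr : ¬ minimalPeriod g x ∣ r := by
    rwa [← isPeriodicPt_iff_minimalPeriod_dvd, IsPeriodicPt, IsFixedPt, Perm.iterate_eq_pow]
  obtain ⟨A, e, he, hA⟩ := exists_bijective_phaseCocycle_eq (x := x) hgw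
  calc
    _ = toCircle (r • A) * ∑ i, (toCircle (r • ZMod.toAddCircle (e i)) : ℂ) := by
      simp only [phaseWeight, hA, smul_add, toCircle_add, Circle.coe_mul, Finset.mul_sum]
    _ = 0 := by
      rw [he.sum_comp fun z => (toCircle (r • ZMod.toAddCircle z) : ℂ),
        sum_toCircle_nsmul_toAddCircle hr, mul_zero]

variable [Fintype α] [DecidableEq α]

open Classical in
theorem sum_phaseWeight_eq_zero {r : ℕ} (hr : g ^ r ≠ 1) :
    ∑ w : Perm α with Commute g w, phaseWeight r g w = 0 := by
  obtain ⟨x, hx⟩ : ∃ x, (g ^ r) x ≠ x := by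
    by_contra! h
    exact hr (Perm.ext h)
  have : NeZero (minimalPeriod g x) := ⟨(minimalPeriod_perm_pos g x).ne'⟩
  have haverage : minimalPeriod g x • ∑ w : Perm α with Commute g w, phaseWeight r g w = 0 := calc
    _ = ∑ i : ZMod (minimalPeriod g x), ∑ w : Perm α with Commute g w,
          phaseWeight r g (w * g.cycleOf x ^ i.val) := by
      simp only [sum_mul_of_commute ((commute_cycleOf g x).pow_right _) (phaseWeight r g),
        Finset.sum_const, Finset.card_univ, ZMod.card]
    _ = 0 := by
      rw [Finset.sum_comm]
      exact Finset.sum_eq_zero fun w hw =>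
        sum_phaseWeight_mul_cycleOf_pow_eq_zero (Finset.mem_filter.1 hw).2 hx
  exact (smul_eq_zero.1 haverage).resolve_left (NeZero.ne _)

open Classical in
theorem sum_phaseWeight_eq_ite (r : ℕ) (g : Perm α) :
    ∑ w : Perm α with Commute g w, phaseWeight r g w =
      if g ^ r = 1 then (Nat.card (Subgroup.centralizer {g}) : ℂ) else 0 := by
  split_ifs with hr
  · rw [Finset.sum_congr rfl fun w hw =>
      phaseWeight_eq_one_of_pow_eq_one (Finset.mem_filter.1 hw).2 hr, ← Finset.cast_card,
      ← Fintype.card_subtype, ← Nat.card_eq_fintype_card]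
    congr 1
    exact Nat.card_congr (Equiv.subtypeEquivRight fun w =>
      Subgroup.mem_centralizer_singleton_iff.trans eq_comm |>.symm)
  · exact sum_phaseWeight_eq_zero hr

end PhaseWeight

section TwistedPermRep

variable {k G X : Type*} [Group G] [MulAction G X]

/-- The representation of `G` on the functions on a `G`-set `X`, twisted by a multiplicative
cocycle `c`: the element `g` sends the indicator function of `x` to `c g x` times that
of `g • x`. -/
def twistedPermRep [CommSemiring k] (c : G → X → k) (hone : ∀ x, c 1 x = 1)
    (hmul : ∀ g h x, c (g * h) x = c g (h • x) * c h x) : Representation k G (X → k) where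
  toFun g :=
    { toFun f x := c g (g⁻¹ • x) * f (g⁻¹ • x)
      map_add' f f' := by ext x; simp [mul_add]
      map_smul' a f := by ext x; simp [mul_left_comm] }
  map_one' := by ext f x; simp [hone]
  map_mul' g h := by ext f x; simp [hmul, mul_smul, mul_assoc]

theorem twistedPermRep_character [Field k] [Fintype X] [DecidableEq X] {c : G → X → k}
    (hone : ∀ x, c 1 x = 1) (hmul : ∀ g h x, c (g * h) x = c g (h • x) * c h x) (g : G) :
    (twistedPermRep c hone hmul).character g = ∑ x : X with g • x = x, c g x := by
  rw [Representation.character, LinearMap.trace_eq_matrix_trace k (Pi.basisFun k X), Matrix.trace,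
    Finset.sum_filter]
  refine Finset.sum_congr rfl fun x _ => ?_
  split_ifs with hx
  · simp [twistedPermRep, inv_smul_eq_iff.2 hx.symm]
  · simp [twistedPermRep, inv_smul_eq_iff.not.2 (Ne.symm hx)]

end TwistedPermRep

/-- The conjugation representation of the symmetric group twisted by `phaseWeight r`. -/
noncomputable def twistedConjRep (α : Type*) [Finite α] (r : ℕ) :
    Representation ℂ (Perm α) (Perm α → ℂ) :=
  (twistedPermRep (G := ConjAct (Perm α)) (fun g w => phaseWeight r (ConjAct.ofConjAct g) w)
    (phaseWeight_one r) fun _ _ => phaseWeight_mul r _ _).comp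
    (ConjAct.toConjAct : Perm α ≃* ConjAct (Perm α)).toMonoidHom

theorem twistedConjRep_character {α : Type*} [Fintype α] [DecidableEq α] (r : ℕ) (g : Perm α) :
    (twistedConjRep α r).character g =
      if g ^ r = 1 then (Nat.card (Subgroup.centralizer {g}) : ℂ) else 0 := by
  classical
  have hcharacter := twistedPermRep_character
    (c := fun (g : ConjAct (Perm α)) w => phaseWeight r (ConjAct.ofConjAct g) w)
    (phaseWeight_one r) (fun _ _ => phaseWeight_mul r _ _) (ConjAct.toConjAct g)
  refine Eq.trans hcharacter ?_
  rw [← sum_phaseWeight_eq_ite]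
  refine Finset.sum_congr (Finset.filter_congr fun w _ => ?_) fun _ _ => rfl
  rw [ConjAct.toConjAct_smul, mul_inv_eq_iff_eq_mul]
  rfl

section CycleType

theorem card_isConj_mul_card_centralizer {G : Type*} [Group G] (g : G) :
    Nat.card {h : G // IsConj g h} * Nat.card (Subgroup.centralizer {g}) = Nat.card G := by
  have horbit : MulAction.orbit (ConjAct G) g = {h | IsConj g h} := by
    ext h
    exact ConjAct.mem_orbit_conjAct.trans isConj_comm
  have hcard := Subgroup.index_mul_card (MulAction.stabilizer (ConjAct G) g)
  rw [MulAction.index_stabilizer, horbit] at hcard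
  rw [Subgroup.nat_card_centralizer_nat_card_stabilizer]
  exact hcard

theorem sum_card_centralizer_of_isConj {G : Type*} [Group G] [Fintype G] (g : G)
    [DecidablePred (IsConj g)] :
    ∑ h : G with IsConj g h, Nat.card (Subgroup.centralizer {h}) = Nat.card G := by
  have hcard (h : G) (hgh : IsConj g h) : Nat.card (Subgroup.centralizer {h}) =
      Nat.card (Subgroup.centralizer {g}) := by
    have hclass : Nat.card {a : G // IsConj h a} = Nat.card {a : G // IsConj g a} :=
      Nat.card_congr (Equiv.subtypeEquivRight fun _ => ⟨hgh.trans, hgh.symm.trans⟩)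
    have : Nonempty {a : G // IsConj g a} := ⟨g, IsConj.refl g⟩
    refine Nat.eq_of_mul_eq_mul_left (Nat.card_pos (α := {a : G // IsConj g a})) ?_
    rw [card_isConj_mul_card_centralizer, ← hclass, card_isConj_mul_card_centralizer]
  rw [Finset.sum_congr rfl fun h hh => hcard h (Finset.mem_filter.1 hh).2, Finset.sum_const,
    smul_eq_mul, ← Fintype.card_subtype, ← Nat.card_eq_fintype_card,
    card_isConj_mul_card_centralizer]

theorem filter_two_le_add_replicate_one {m : Multiset ℕ} (hm : ∀ i ∈ m, 0 < i) :
    m.filter (2 ≤ ·) + Multiset.replicate (m.sum - (m.filter (2 ≤ ·)).sum) 1 = m := by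
  have hones : m.filter (¬ 2 ≤ ·) =
      Multiset.replicate (m.filter (¬ 2 ≤ ·)).card 1 := Multiset.eq_replicate_card.2 fun i hi => by
    have hpos := hm i (Multiset.mem_of_mem_filter hi)
    have hlt := Multiset.of_mem_filter hi
    omega
  have hsum := congrArg Multiset.sum (Multiset.filter_add_not (2 ≤ ·) m)
  rw [Multiset.sum_add, hones, Multiset.sum_replicate, smul_eq_mul, mul_one] at hsum
  rw [← hsum, Nat.add_sub_cancel_left, ← hones, Multiset.filter_add_not]

variable {α : Type*} [Fintype α] [DecidableEq α]

theorem exists_perm_partition_eq (lam : (Fintype.card α).Partition) :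
    ∃ w : Perm α, w.partition = lam := by
  have hparts := filter_two_le_add_replicate_one fun _ => lam.parts_pos
  rw [lam.parts_sum] at hparts
  have hsum : (lam.parts.filter (2 ≤ ·)).sum ≤ Fintype.card α := by
    have hsum_add := congrArg Multiset.sum hparts
    rw [Multiset.sum_add] at hsum_add
    exact Nat.le.intro (hsum_add.trans lam.parts_sum)
  obtain ⟨w, hw⟩ := (Perm.exists_with_cycleType_iff α).2
    ⟨hsum, fun _ => Multiset.of_mem_filter⟩
  refine ⟨w, Nat.Partition.ext ?_⟩
  rw [Perm.parts_partition, ← Perm.sum_cycleType, hw, hparts]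

theorem pow_eq_one_iff_forall_parts_dvd (w : Perm α) (r : ℕ) :
    w ^ r = 1 ↔ ∀ i ∈ w.partition.parts, i ∣ r := by
  have hone : ∀ i ∈ Multiset.replicate (Fintype.card α - w.support.card) 1, i ∣ r := fun i hi =>
    Multiset.eq_of_mem_replicate hi ▸ one_dvd r
  rw [← orderOf_dvd_iff_pow_eq_one, ← Perm.lcm_cycleType, Multiset.lcm_dvd, Perm.parts_partition]
  simp only [Multiset.mem_add, or_imp, forall_and]
  exact (and_iff_left hone).symm

theorem sum_card_centralizer_of_partition_eq (lam : (Fintype.card α).Partition) :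
    ∑ w : Perm α with w.partition = lam, Nat.card (Subgroup.centralizer {w}) =
      (Fintype.card α)! := by
  obtain ⟨w, rfl⟩ := exists_perm_partition_eq lam
  have hsum := sum_card_centralizer_of_isConj w
  rw [Nat.card_eq_fintype_card, Fintype.card_perm] at hsum
  refine (Finset.sum_congr (Finset.filter_congr fun v _ => ?_) fun _ _ => rfl).trans hsum
  rw [Perm.partition_eq_of_isConj, eq_comm]

end CycleType

section FrobeniusChar

theorem sum_ite_card_centralizer_smul_powerSumPart (α : Type*) [Fintype α] [DecidableEq α]
    (P : ℕ → Prop) [DecidablePred P] :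
    ∑ w : Perm α, (if ∀ i ∈ w.partition.parts, P i then
      (Nat.card (Subgroup.centralizer {w}) : ℂ) else 0) • powerSumPart w.partition =
        ((Fintype.card α)! : ℂ) • powerSumSum (Fintype.card α) P := by
  rw [powerSumSum, ← Finset.sum_fiberwise Finset.univ fun w : Perm α => w.partition,
    Finset.smul_sum, Finset.sum_filter]
  refine Finset.sum_congr rfl fun lam _ => ?_
  have hterm (w : Perm α) (hw : w ∈ Finset.univ.filter fun w => w.partition = lam) :
      (if ∀ i ∈ w.partition.parts, P i then (Nat.card (Subgroup.centralizer {w}) : ℂ) else 0) •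
        powerSumPart w.partition = if ∀ i ∈ lam.parts, P i then
          (Nat.card (Subgroup.centralizer {w}) : ℂ) • powerSumPart lam else 0 := by
    rw [(Finset.mem_filter.1 hw).2, ite_smul, zero_smul]
  rw [Finset.sum_congr rfl hterm]
  split_ifs
  · rw [← Finset.sum_smul, ← Nat.cast_sum, sum_card_centralizer_of_partition_eq]
  · exact Finset.sum_const_zero

variable {n : ℕ}

theorem powerSumSum_congr {P Q : ℕ → Prop}
    (h : ∀ i, 0 < i → i ≤ n → (P i ↔ Q i)) : powerSumSum n P = powerSumSum n Q := by
  classical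
  refine Finset.sum_congr (Finset.filter_congr fun lam _ => forall₂_congr fun i hi => ?_)
    fun _ _ => rfl
  exact h i (lam.parts_pos hi) ((Multiset.le_sum_of_mem hi).trans_eq lam.parts_sum)

theorem frobeniusChar_twistedConjRep (n r : ℕ) :
    frobeniusChar (twistedConjRep (Fin n) r) = powerSumSum n (· ∣ r) := by
  rw [frobeniusChar, inv_smul_eq_iff₀ (Nat.cast_ne_zero.2 n.factorial_ne_zero)]
  simp only [twistedConjRep_character, pow_eq_one_iff_forall_parts_dvd]
  refine (sum_ite_card_centralizer_smul_powerSumPart (Fin n) (· ∣ r)).trans ?_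
  rw [Fintype.card_fin]

theorem sign_eq_one_of_odd_pow_eq_one {w : Perm (Fin n)} {r : ℕ} (hr : Odd r) (hw : w ^ r = 1) :
    Perm.sign w = 1 := by
  have hpow : Perm.sign w ^ r = 1 := by rw [← map_pow, hw, map_one]
  rcases Int.units_eq_one_or (Perm.sign w) with h | h
  · exact h
  · rw [h, hr.neg_one_pow] at hpow
    exact absurd hpow (by decide)

theorem signRep_character (w : Perm (Fin n)) :
    (signRep n).character w = ((Perm.sign w : ℤ) : ℂ) := by
  simp [Representation.character, signRep]

theorem isSelfConjugate_twistedConjRep (n : ℕ) {r : ℕ} (hr : Odd r) :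
    IsSelfConjugate (twistedConjRep (Fin n) r) := by
  refine nonempty_equiv_of_character_eq _ _ (funext fun w => ?_)
  rw [Representation.char_tensor, Pi.mul_apply, signRep_character, twistedConjRep_character]
  split_ifs with hw
  · rw [sign_eq_one_of_odd_pow_eq_one hr hw, Units.val_one, Int.cast_one, mul_one]
  · rw [zero_mul]

theorem finrank_perm_fun (n : ℕ) : Module.finrank ℂ (Perm (Fin n) → ℂ) = n ! := by
  rw [Module.finrank_fintype_fun_eq_card, Fintype.card_perm, Fintype.card_fin]

end FrobeniusChar

theorem finset_lcm_induction {ι M : Type*} [CommMonoidWithZero M] [NormalizedGCDMonoid M]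
    {P : M → Prop} (hone : P 1) (hlcm : ∀ a b, P a → P b → P (lcm a b)) {s : Finset ι} {f : ι → M}
    (hs : ∀ i ∈ s, P (f i)) : P (s.lcm f) := by
  classical
  induction s using Finset.induction_on with
  | empty => exact hone
  | insert i s _ ih =>
    rw [Finset.lcm_insert]
    exact hlcm _ _ (hs i (Finset.mem_insert_self i s))
      (ih fun j hj => hs j (Finset.mem_insert_of_mem hj))

theorem exists_forall_le_dvd_iff (n : ℕ) {P : ℕ → Prop} (hone : P 1)
    (hdvd : ∀ i j, i ∣ j → P j → P i) (hlcm : ∀ i j, P i → P j → P (i.lcm j)) :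
    ∃ r, P r ∧ ∀ i, 0 < i → i ≤ n → (i ∣ r ↔ P i) := by
  classical
  have hP : P (((Finset.Icc 1 n).filter P).lcm id) :=
    finset_lcm_induction hone hlcm fun i hi => (Finset.mem_filter.1 hi).2
  exact ⟨_, hP, fun i hpos hle => ⟨fun hi => hdvd i _ hi hP, fun hi =>
    Finset.dvd_lcm (f := id) (Finset.mem_filter.2 ⟨Finset.mem_Icc.2 ⟨hpos, hle⟩, hi⟩)⟩⟩

theorem exists_frobeniusChar_eq_powerSumSum (n : ℕ) {P : ℕ → Prop} (hone : P 1)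
    (hdvd : ∀ i j, i ∣ j → P j → P i) (hlcm : ∀ i j, P i → P j → P (i.lcm j)) :
    ∃ (V : Type) (_ : AddCommGroup V) (_ : Module ℂ V) (_ : FiniteDimensional ℂ V)
      (ρ : Representation ℂ (Equiv.Perm (Fin n)) V),
      frobeniusChar ρ = powerSumSum n P ∧ Module.finrank ℂ V = n ! ∧
        ((∀ i, P i → Odd i) → IsSelfConjugate ρ) := by
  obtain ⟨r, hr, hdvd_iff⟩ := exists_forall_le_dvd_iff n hone hdvd hlcm
  exact ⟨_, _, _, inferInstance, twistedConjRep (Fin n) r,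
    (frobeniusChar_twistedConjRep n r).trans (powerSumSum_congr hdvd_iff), finrank_perm_fun n,
    fun hodd => isSelfConjugate_twistedConjRep n (hodd r hr)⟩

theorem exists_eq_pow_of_dvd {q : ℕ} (hq : q.Prime) (i j : ℕ) (hij : i ∣ j)
    (hj : ∃ k, j = q ^ k) : ∃ k, i = q ^ k := by
  obtain ⟨k, rfl⟩ := hj
  exact ((Nat.dvd_prime_pow hq).1 hij).imp fun _ h => h.2

theorem exists_lcm_eq_pow (q i j : ℕ) (hi : ∃ k, i = q ^ k) (hj : ∃ k, j = q ^ k) :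
    ∃ k, i.lcm j = q ^ k := by
  obtain ⟨⟨a, rfl⟩, ⟨b, rfl⟩⟩ := And.intro hi hj
  rcases le_total a b with hab | hab
  · exact ⟨b, Nat.lcm_eq_right (pow_dvd_pow q hab)⟩
  · exact ⟨a, Nat.lcm_eq_left (pow_dvd_pow q hab)⟩

theorem mainTheorem10 (q : ℕ) (hq : q.Prime) (n : ℕ) :
    (∃ (V : Type) (_ : AddCommGroup V) (_ : Module ℂ V) (_ : FiniteDimensional ℂ V)
        (ρ : Representation ℂ (Equiv.Perm (Fin n)) V),
      frobeniusChar ρ = powerSumSum n (fun i => ∃ k : ℕ, i = q ^ k) ∧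
      Module.finrank ℂ V = n ! ∧
      (Odd q → IsSelfConjugate ρ)) ∧
    (∃ (V : Type) (_ : AddCommGroup V) (_ : Module ℂ V) (_ : FiniteDimensional ℂ V)
        (ρ : Representation ℂ (Equiv.Perm (Fin n)) V),
      frobeniusChar ρ = powerSumSum n (fun i => Nat.Coprime i q) ∧
      Module.finrank ℂ V = n !) ∧
    (Odd q →
      ∃ (V : Type) (_ : AddCommGroup V) (_ : Module ℂ V) (_ : FiniteDimensional ℂ V)
        (ρ : Representation ℂ (Equiv.Perm (Fin n)) V),
      frobeniusChar ρ = powerSumSum n (fun i => Odd i ∧ Nat.Coprime i q) ∧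
      Module.finrank ℂ V = n !) := by
  have hcoprime_lcm (i j : ℕ) (hi : i.Coprime q) (hj : j.Coprime q) : (i.lcm j).Coprime q :=
    (hi.mul_left hj).coprime_dvd_left (Nat.lcm_dvd_mul i j)
  refine ⟨?_, ?_, fun _ => ?_⟩
  · obtain ⟨V, _, _, _, ρ, hch, hdim, hself⟩ := exists_frobeniusChar_eq_powerSumSum n
      ⟨0, (pow_zero q).symm⟩ (exists_eq_pow_of_dvd hq) (exists_lcm_eq_pow q)
    exact ⟨V, _, _, ‹_›, ρ, hch, hdim, fun hodd => hself fun _ ⟨_, hk⟩ => hk ▸ hodd.pow⟩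
  · obtain ⟨V, _, _, _, ρ, hch, hdim, -⟩ := exists_frobeniusChar_eq_powerSumSum n
      (P := (·.Coprime q)) (Nat.coprime_one_left q) (fun _ _ hij hj => hj.coprime_dvd_left hij)
      hcoprime_lcm
    exact ⟨V, _, _, ‹_›, ρ, hch, hdim⟩
  · obtain ⟨V, _, _, _, ρ, hch, hdim, -⟩ := exists_frobeniusChar_eq_powerSumSum n
      (P := fun i => Odd i ∧ i.Coprime q) ⟨odd_one, Nat.coprime_one_left q⟩
      (fun _ _ hij hj => ⟨hj.1.of_dvd_nat hij, hj.2.coprime_dvd_left hij⟩)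
      fun i j hi hj =>
        ⟨(hi.1.mul hj.1).of_dvd_nat (Nat.lcm_dvd_mul i j), hcoprime_lcm i j hi.2 hj.2⟩
    exact ⟨V, _, _, ‹_›, ρ, hch, hdim⟩
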